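/- **Games.** An arena consists of a set $V$ of nodes, a subset $V_\exists\subseteq V$ of nodes owned by player $\exists$ (the other nodes are owned by player $\forall$) and a set $E\subseteq V\times V$ of moves such that every node has at least one outgoing move. A strategy for $\exists$ assigns to every finite play ending in a node $v\in V_\exists$ a node $w$ with $(v,w)\in E$. Player $\exists$ wins a game from $v$ if they have a strategy such that every infinite play that starts at $v$ and is compatible with the strategy satisfies the objective. An Emerson-Lei game $G$ with finite set $C$ of colors is an arena with a coloring $\gamma:E\to 2^C$ and a positive Boolean formula $\varphi$ over the atoms $\mathsf{Inf}\,c$, $\mathsf{Fin}\,c$ ($c\in C$); a play $v_0v_1\ldots$ satisfies $\mathsf{Inf}\,c$ (resp. $\mathsf{Fin}\,c$) iff $c\in\gamma(v_i,v_{i+1})$ for infinitely (resp. only finitely) many $i$, and the objective consists of all infinite plays that satisfy $\varphi$. For a set $D\subseteq C$ we write $D\models\varphi$ if $\varphi$ is true when $\mathsf{Inf}\,c$ is read as $c\in D$ and $\mathsf{Fin}\,c$ as $c\notin D$. In a parity game each move has a priority in $\mathbb N$, and a play satisfies the objective iff the maximal priority that it visits infinitely often exists and is even. **Construction.** Let $\Pi(C)$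 be the set of permutations of $C$ (arrangements of the elements of $C$ in a sequence). For $\pi\in\Pi(C)$ and $D\subseteq C$ let $p(\pi,D)\in\{0,\dots,|C|\}$ be the right-most position in $\pi$ that holds an element of $D$, where $p(\pi,\emptyset)=0$; let $\pi@D$ be obtained from $\pi$ by moving the element at position $p(\pi,D)$ to the front, where $\pi@\emptyset=\pi$; and let $\pi[i]$ be the set of colors in the first $i$ positions of $\pi$. The parity game $P(G)$ has node set $V\times\Pi(C)$, the nodes in $V_\exists\times\Pi(C)$ being owned by $\exists$, and for each $(v,\pi)$ and each $(v,w)\in E$ a move from $(v,\pi)$ to $(w,\pi@\gamma(v,w))$; with $p=p(\pi,\gamma(v,w))$, this move has priority $2p$ if $\pi[p]\models\varphi$ and priority $2p+1$ otherwise. **Lemma.** Let $G$ be an Emerson-Lei game with node set $V$ and finite set $C$ of colors. Then $P(G)$ has $|V|\cdot|C|!$ nodes; all its priorities lie in $\{0,\dots,2|C|+1\}$, the priority of a move from $(v,\pi)$ to $(w,\pi')$ lies in $\{1,\dots,2|C|+1\}$ whenever $\gamma(v,w)\neq\emptyset$ or $\emptyset\not\models\varphi$, and at most $2|C|+1$ different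 priorities occur on moves of $P(G)$. Moreover, for all $v\in V$ and $\pi\in\Pi(C)$, player $\exists$ wins from $v$ in $G$ if and only if player $\exists$ wins from $(v,\pi)$ in $P(G)$. -/

import Mathlib

/-! ## Arenas, plays, strategies -/

/-- An arena on the node set `V`: the nodes owned by player ∃ (all other nodes are owned by
player ∀) and the moves, where every node has at least one outgoing move. -/
structure Arena (V : Type*) where
  /-- the nodes owned by player ∃ -/
  VE : Set V
  /-- the moves -/
  E : V → V → Prop
  /-- there are no deadlocks -/
  serial : ∀ v, ∃ w, E v w

namespace Arena

variable {V : Type*} (A : Arena V)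

/-- `ρ` is an infinite play. -/
def IsPlay (ρ : ℕ → V) : Prop := ∀ n, A.E (ρ n) (ρ (n + 1))

/-- A strategy for player ∃ assigns to each finite play `h v` that ends in a node `v` of
player ∃ a node to which there is a move from `v`. (The values of `σ` on
lists that are not of this shape are irrelevant.) -/
def IsStrategy (σ : List V → V) : Prop :=
  ∀ (h : List V) (v : V), List.IsChain A.E (h ++ [v]) → v ∈ A.VE → A.E v (σ (h ++ [v]))

/-- The sequence `ρ` is compatible with the strategy `σ` for player ∃: whenever `ρ j` belongs to
player ∃, the next node is `σ (ρ 0, …, ρ j)`. -/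
def Compatible (σ : List V → V) (ρ : ℕ → V) : Prop :=
  ∀ j, ρ j ∈ A.VE → ρ (j + 1) = σ ((List.range (j + 1)).map ρ)

/-- Player ∃ wins the standard game with arena `A` and objective `α` from `v`: some strategy is
such that all plays that start at `v` and are compatible with it satisfy `α`. -/
def ExistsWins (α : Set (ℕ → V)) (v : V) : Prop :=
  ∃ σ : List V → V, A.IsStrategy σ ∧
    ∀ ρ : ℕ → V, A.IsPlay ρ → ρ 0 = v → A.Compatible σ ρ → ρ ∈ α

end Arena

/-! ## Emerson-Lei games -/

/-- Positive Boolean formulas over the atoms `Inf c` and `Fin c`. -/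
inductive ELFormula (C : Type*) where
  | inf (c : C) : ELFormula C
  | fin (c : C) : ELFormula C
  | tt : ELFormula C
  | ff : ELFormula C
  | and (φ ψ : ELFormula C) : ELFormula C
  | or (φ ψ : ELFormula C) : ELFormula C

namespace ELFormula

variable {C : Type*}

/-- Satisfaction by an infinite sequence of sets of colors. -/
def Sat (s : ℕ → Finset C) : ELFormula C → Prop
  | inf c => {i | c ∈ s i}.Infinite
  | fin c => {i | c ∈ s i}.Finite
  | tt => True
  | ff => False
  | and φ ψ => φ.Sat s ∧ ψ.Sat s
  | or φ ψ => φ.Sat s ∨ ψ.Sat s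

/-- Satisfaction by a set `D` of colors, understood as the set of colors that occur infinitely
often: `D ⊨ Inf c` iff `c ∈ D`, and `D ⊨ Fin c` iff `c ∉ D`. -/
def SatSet (D : Set C) : ELFormula C → Prop
  | inf c => c ∈ D
  | fin c => c ∉ D
  | tt => True
  | ff => False
  | and φ ψ => φ.SatSet D ∧ ψ.SatSet D
  | or φ ψ => φ.SatSet D ∨ ψ.SatSet D

end ELFormula

/-- An Emerson-Lei game: an arena, a coloring of the moves by sets of colors, and a formula.
(The values of `γ` on pairs of nodes that are not moves are irrelevant.) -/
structure ELGame (V C : Type*) extends Arena V where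
  /-- the coloring function -/
  γ : V → V → Finset C
  /-- the formula that defines the objective -/
  φ : ELFormula C

namespace ELGame

variable {V C : Type*} (G : ELGame V C)

/-- The objective: the infinite plays whose sequence of sets of colors satisfies the formula. -/
def objective : Set (ℕ → V) :=
  {ρ | G.toArena.IsPlay ρ ∧ G.φ.Sat (fun n => G.γ (ρ n) (ρ (n + 1)))}

/-- Player ∃ wins the Emerson-Lei game from `v`. -/
def Wins (v : V) : Prop := G.toArena.ExistsWins G.objective v

end ELGame

/-! ## Parity games -/

/-- A parity game: an arena with priorities on the moves.
(The values of `Ω` on pairs of nodes that are not moves are irrelevant.) -/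
structure ParityGame (V : Type*) extends Arena V where
  /-- the priority function -/
  Ω : V → V → ℕ

namespace ParityGame

variable {V : Type*} (P : ParityGame V)

/-- The priorities that occur on moves of the game. -/
def priorities : Set ℕ := {k | ∃ x y, P.E x y ∧ P.Ω x y = k}

/-- The parity objective: some even priority is visited infinitely often, and all larger ones only
finitely often. -/
def objective : Set (ℕ → V) :=
  {ρ | P.toArena.IsPlay ρ ∧ ∃ i, Even i ∧ {n | P.Ω (ρ n) (ρ (n + 1)) = i}.Infinite ∧
    ∀ j, i < j → {n | P.Ω (ρ n) (ρ (n + 1)) = j}.Finite}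

/-- Player ∃ wins the parity game from `v`. -/
def Wins (v : V) : Prop := P.toArena.ExistsWins P.objective v

end ParityGame

/-! ## The lazy later-appearance record -/

/-- Permutations over `C`, as arrangements of the elements of `C`: `π i` is the color at position
`i + 1` of `π` (positions are counted from `1`), and `π.symm c + 1` is the position of `c`. -/
abbrev ColorPerm (C : Type*) [Fintype C] := Fin (Fintype.card C) ≃ C

namespace ColorPerm

variable {C : Type*} [Fintype C]

/-- The (zero-based) index of the right-most element of the nonempty set `D` in `π`. -/
def lastIdx (π : ColorPerm C) (D : Finset C) (h : D.Nonempty) : Fin (Fintype.card C) :=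
  D.sup' h (fun c => π.symm c)

/-- The right-most position of `π` (counted from `1`) that holds an element of `D`;
it is `0` if `D` is empty. -/
def lastPos (π : ColorPerm C) (D : Finset C) : ℕ :=
  if h : D.Nonempty then (π.lastIdx D h : ℕ) + 1 else 0

/-- `π @ D`: the element of `D` that occurs right-most in `π` is moved to the front, and the
elements before it are shifted by one; `π @ ∅ = π`. Here `Fin.cycleRange i` sends `i` to `0` and
each `j < i` to `j + 1`, and it fixes all `j > i`. -/
def moveToFront (π : ColorPerm C) (D : Finset C) : ColorPerm C :=
  if h : D.Nonempty then (Fin.cycleRange (π.lastIdx D h)).symm.trans π else π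

/-- `π[i]`: the colors in the first `i` positions of `π`. -/
def firstColors (π : ColorPerm C) (i : ℕ) : Set C := {c | (π.symm c : ℕ) < i}

end ColorPerm

open Classical in
/-- The parity game `P(G)`. Its nodes are annotated with permutations of the colors; a move
`(v, w)` of `G` updates the permutation `π` to `π @ γ(v, w)`. If `p` is the right-most position of
`π` that holds a color from `γ(v, w)`, then the move has priority `2 p` if `π[p]` satisfies the
formula and `2 p + 1` otherwise. -/
noncomputable def ELGame.parityGame {V C : Type*} [Fintype C] (G : ELGame V C) :
    ParityGame (V × ColorPerm C) where
  VE := {x | x.1 ∈ G.VE}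
  E x y := G.E x.1 y.1 ∧ y.2 = x.2.moveToFront (G.γ x.1 y.1)
  serial x := by
    obtain ⟨w, hw⟩ := G.serial x.1
    exact ⟨(w, x.2.moveToFront (G.γ x.1 w)), hw, rfl⟩
  Ω x y :=
    if G.φ.SatSet (x.2.firstColors (x.2.lastPos (G.γ x.1 y.1)))
    then 2 * x.2.lastPos (G.γ x.1 y.1)
    else 2 * x.2.lastPos (G.γ x.1 y.1) + 1

universe u w

open Filter

/-! ## Moving colors to the front -/

namespace ColorPerm

variable {C : Type*} [Fintype C]

/-! Along a play let `m` be the largest right-most position occurring infinitely often. Eventually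
only the first `m` positions are permuted, so they hold a fixed set of colors. This set is exactly
the set `S` of colors seen infinitely often: such a color is always found there, while any other
color in it would eventually only move right, one step at each occurrence of `m`, forever. Hence the
largest priority seen infinitely often is `2m` or `2m+1`, according to whether `S` satisfies the
formula (`exists_frequently_lastPos_eq`, `mem_objective_iff_mem_parityGame_objective`). Permutations
are determined by the history of nodes, so plays and strategies transfer in both directions. -/

theorem lastPos_le_card (π : ColorPerm C) (D : Finset C) : π.lastPos D ≤ Fintype.card C := by
  unfold lastPos
  split_ifs with h
  · exact (π.lastIdx D h).isLt
  · exact Nat.zero_le _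

@[simp]
theorem lastPos_empty (π : ColorPerm C) : π.lastPos ∅ = 0 := by
  simp [lastPos]

theorem lastPos_pos (π : ColorPerm C) {D : Finset C} (h : D.Nonempty) : 0 < π.lastPos D := by
  simp [lastPos, h]

@[simp]
theorem firstColors_zero (π : ColorPerm C) : π.firstColors 0 = ∅ := by
  simp [firstColors]

theorem symm_lt_lastPos (π : ColorPerm C) {D : Finset C} {c : C} (hc : c ∈ D) :
    (π.symm c : ℕ) < π.lastPos D := by
  have h : D.Nonempty := ⟨c, hc⟩
  have h' : π.symm c ≤ π.lastIdx D h := Finset.le_sup' (fun c => π.symm c) hc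
  rw [lastPos, dif_pos h]
  exact Nat.lt_succ_of_le h'

theorem moveToFront_symm_of_lastPos_le (π : ColorPerm C) {D : Finset C} {c : C}
    (hc : π.lastPos D ≤ π.symm c) : (π.moveToFront D).symm c = π.symm c := by
  by_cases h : D.Nonempty
  · rw [lastPos, dif_pos h] at hc
    simp only [moveToFront, dif_pos h, Equiv.symm_trans_apply, Equiv.symm_symm]
    exact Fin.cycleRange_of_gt hc
  · simp [moveToFront, h]

theorem moveToFront_symm_of_lt_lastPos (π : ColorPerm C) {D : Finset C} {c : C} (hcD : c ∉ D)
    (hc : (π.symm c : ℕ) < π.lastPos D) :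
    ((π.moveToFront D).symm c : ℕ) = π.symm c + 1 := by
  by_cases h : D.Nonempty
  · rw [lastPos, dif_pos h] at hc
    simp only [moveToFront, dif_pos h, Equiv.symm_trans_apply, Equiv.symm_symm]
    -- The position is strictly smaller because the color at `lastIdx` itself belongs to `D`.
    refine Fin.coe_cycleRange_of_lt (lt_of_le_of_ne (Nat.le_of_lt_succ hc) fun heq => hcD ?_)
    obtain ⟨d, hd, hd'⟩ := Finset.exists_mem_eq_sup' h (fun c => π.symm c)
    rwa [π.symm.injective (heq.trans hd')]
  · simp [lastPos, h] at hc

theorem symm_le_moveToFront_symm (π : ColorPerm C) {D : Finset C} {c : C} (hcD : c ∉ D) :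
    (π.symm c : ℕ) ≤ (π.moveToFront D).symm c := by
  rcases le_or_gt (π.lastPos D) (π.symm c) with h | h
  · rw [π.moveToFront_symm_of_lastPos_le h]
  · rw [π.moveToFront_symm_of_lt_lastPos hcD h]
    exact Nat.le_succ _

/-- Positions from `m` on are fixed, which gives one inclusion; equal cardinality gives the other.
-/
theorem firstColors_moveToFront (π : ColorPerm C) {D : Finset C} {m : ℕ} (h : π.lastPos D ≤ m) :
    (π.moveToFront D).firstColors m = π.firstColors m := by
  have hsub : π.firstColors m ⊇ (π.moveToFront D).firstColors m := by
    intro c hc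
    by_contra hc'
    have hc' : m ≤ π.symm c := not_lt.mp hc'
    have hc : ((π.moveToFront D).symm c : ℕ) < m := hc
    rw [π.moveToFront_symm_of_lastPos_le (h.trans hc')] at hc
    omega
  have hcard (π' : ColorPerm C) :
      (π'.firstColors m).ncard = {i : Fin (Fintype.card C) | (i : ℕ) < m}.ncard := by
    rw [← Set.ncard_preimage_of_injective_subset_range (f := π') π'.injective
      (by simp [π'.surjective.range_eq])]
    simp [firstColors]
  exact Set.eq_of_subset_of_ncard_le hsub (by rw [hcard, hcard]) (Set.toFinite _)

/-- In a sequence of permutations that is updated by sets of colors, let `m` be the largest position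
that is moved to the front infinitely often. Eventually, the first `m` positions hold
the colors that occur infinitely often. -/
theorem exists_frequently_lastPos_eq (s : ℕ → Finset C) (π : ℕ → ColorPerm C)
    (hπ : ∀ n, π (n + 1) = (π n).moveToFront (s n)) :
    ∃ m, (∃ᶠ n in atTop, (π n).lastPos (s n) = m) ∧
      ∀ᶠ n in atTop, (π n).lastPos (s n) ≤ m ∧
        (π n).firstColors m = {c | ∃ᶠ n in atTop, c ∈ s n} := by
  classical
  let Q : ℕ → Prop := fun m => ∃ᶠ n in atTop, m ≤ (π n).lastPos (s n)
  have hQ0 : Q 0 := Frequently.of_forall fun _ => Nat.zero_le _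
  set m := Nat.findGreatest Q (Fintype.card C)
  have hQm : Q m := Nat.findGreatest_spec (Nat.zero_le _) hQ0
  have hle : ∀ᶠ n in atTop, (π n).lastPos (s n) ≤ m := by
    have hnot : ¬ Q (m + 1) := by
      intro h
      obtain ⟨n, hn⟩ := h.exists
      have h' : m + 1 ≤ m := Nat.le_findGreatest (hn.trans (lastPos_le_card _ _)) h
      omega
    filter_upwards [not_frequently.mp hnot] with n hn
    omega
  have hfreq : ∃ᶠ n in atTop, (π n).lastPos (s n) = m :=
    (hQm.and_eventually hle).mono fun n hn => le_antisymm hn.2 hn.1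
  refine ⟨m, hfreq, ?_⟩
  obtain ⟨N, hN⟩ := eventually_atTop.mp hle
  have hconst : ∀ n ≥ N, (π n).firstColors m = (π N).firstColors m := by
    intro n hn
    induction n, hn using Nat.le_induction with
    | base => rfl
    | succ n hn ih => rw [hπ, firstColors_moveToFront _ (hN n hn), ih]
  have hT : (π N).firstColors m = {c | ∃ᶠ n in atTop, c ∈ s n} := by
    ext c
    constructor
    · intro hc hfin
      obtain ⟨M, hM⟩ := eventually_atTop.mp hfin
      have hmono : ∀ n ≥ M, ∀ k ≥ n, ((π n).symm c : ℕ) ≤ (π k).symm c := by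
        intro n hn k hk
        induction k, hk using Nat.le_induction with
        | base => rfl
        | succ k hk ih =>
          rw [hπ]
          exact ih.trans (symm_le_moveToFront_symm _ (hM k (hn.trans hk)))
      -- A color of the first `m` positions that no longer occurs is pushed right whenever `m` is
      -- hit, and never moves back; its position would be unbounded.
      have hgrow : ∀ j : ℕ, ∃ n ≥ max M N, j ≤ (π n).symm c := by
        intro j
        induction j with
        | zero => exact ⟨_, le_rfl, Nat.zero_le _⟩
        | succ j ih =>
          obtain ⟨n, hn, hj⟩ := ih
          obtain ⟨k, hk, hkm⟩ := frequently_atTop.mp hfreq n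
          have hkM : M ≤ k := (le_max_left M N).trans (hn.trans hk)
          have hkN : N ≤ k := (le_max_right M N).trans (hn.trans hk)
          have hck : c ∈ (π k).firstColors m := by rwa [hconst k hkN]
          refine ⟨k + 1, (hn.trans hk).trans (Nat.le_succ k), ?_⟩
          rw [hπ, moveToFront_symm_of_lt_lastPos _ (hM k hkM) (by rw [hkm]; exact hck)]
          exact Nat.succ_le_succ (hj.trans (hmono n ((le_max_left M N).trans hn) k hk))
      obtain ⟨n, -, hn⟩ := hgrow (Fintype.card C)
      exact absurd ((π n).symm c).isLt (not_lt.mpr hn)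
    · intro hc
      obtain ⟨n, hn, hcn⟩ := frequently_atTop.mp hc N
      rw [← hconst n hn]
      exact (symm_lt_lastPos _ hcn).trans_le (hN n hn)
  filter_upwards [eventually_ge_atTop N] with n hn
  exact ⟨hN n hn, (hconst n hn).trans hT⟩

end ColorPerm

namespace ELFormula

variable {C : Type*}

theorem sat_iff_satSet (φ : ELFormula C) (s : ℕ → Finset C) :
    φ.Sat s ↔ φ.SatSet {c | ∃ᶠ n in atTop, c ∈ s n} := by
  induction φ with
  | inf c => simp [Sat, SatSet, Nat.frequently_atTop_iff_infinite]
  | fin c => simp [Sat, SatSet, Nat.frequently_atTop_iff_infinite]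
  | tt => rfl
  | ff => rfl
  | and φ ψ hφ hψ => exact and_congr hφ hψ
  | or φ ψ hφ hψ => exact or_congr hφ hψ

end ELFormula

namespace ELGame

variable {V C : Type*} [Fintype C] (G : ELGame V C)

/-! ## Priorities -/

open Classical in
theorem parityGame_Ω (x y : V × ColorPerm C) :
    G.parityGame.Ω x y =
      if G.φ.SatSet (x.2.firstColors (x.2.lastPos (G.γ x.1 y.1)))
      then 2 * x.2.lastPos (G.γ x.1 y.1)
      else 2 * x.2.lastPos (G.γ x.1 y.1) + 1 := rfl

theorem parityGame_Ω_le (x y : V × ColorPerm C) :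
    G.parityGame.Ω x y ≤ 2 * Fintype.card C + 1 := by
  have := x.2.lastPos_le_card (G.γ x.1 y.1)
  rw [parityGame_Ω]
  split_ifs <;> omega

theorem one_le_parityGame_Ω (x y : V × ColorPerm C)
    (h : (G.γ x.1 y.1).Nonempty ∨ ¬ G.φ.SatSet ∅) : 1 ≤ G.parityGame.Ω x y := by
  rw [parityGame_Ω]
  rcases (G.γ x.1 y.1).eq_empty_or_nonempty with he | hne
  · simp_all
  · have := x.2.lastPos_pos hne
    split_ifs <;> omega

theorem parityGame_Ω_ne_one (x y : V × ColorPerm C) (h : G.φ.SatSet ∅) :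
    G.parityGame.Ω x y ≠ 1 := by
  rw [parityGame_Ω]
  rcases (G.γ x.1 y.1).eq_empty_or_nonempty with he | hne
  · simp [he, h]
  · have := x.2.lastPos_pos hne
    split_ifs <;> omega

/-- Priorities 0 and 1 arise only from moves without colors, and whether `∅` satisfies the formula
excludes one of the two. -/
theorem encard_priorities_parityGame_le :
    G.parityGame.priorities.encard ≤ ((2 * Fintype.card C + 1 : ℕ) : ℕ∞) := by
  classical
  have key : ∃ a ∈ Finset.range (2 * Fintype.card C + 2),
      G.parityGame.priorities ⊆ ((Finset.range (2 * Fintype.card C + 2)).erase a : Finset ℕ) := by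
    by_cases h : G.φ.SatSet ∅
    · refine ⟨1, by simp, ?_⟩
      rintro _ ⟨x, y, -, rfl⟩
      have := G.parityGame_Ω_le x y
      have := G.parityGame_Ω_ne_one x y h
      simp only [Finset.coe_erase, Finset.coe_range, Set.mem_sdiff, Set.mem_Iio,
        Set.mem_singleton_iff]
      omega
    · refine ⟨0, by simp, ?_⟩
      rintro _ ⟨x, y, -, rfl⟩
      have := G.parityGame_Ω_le x y
      have := G.one_le_parityGame_Ω x y (Or.inr h)
      simp only [Finset.coe_erase, Finset.coe_range, Set.mem_sdiff, Set.mem_Iio,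
        Set.mem_singleton_iff]
      omega
  obtain ⟨a, ha, hsub⟩ := key
  refine (Set.encard_le_encard hsub).trans ?_
  rw [Set.encard_coe_eq_coe_finsetCard, Finset.card_erase_of_mem ha, Finset.card_range]
  rfl

/-! ## Objectives -/

open Classical in
theorem mem_objective_iff_mem_parityGame_objective {ρ : ℕ → V × ColorPerm C}
    (hρ : G.parityGame.IsPlay ρ) :
    (fun n => (ρ n).1) ∈ G.objective ↔ ρ ∈ G.parityGame.objective := by
  let s : ℕ → Finset C := fun n => G.γ (ρ n).1 (ρ (n + 1)).1
  obtain ⟨m, hfreq, hev⟩ :=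
    ColorPerm.exists_frequently_lastPos_eq s (fun n => (ρ n).2) fun n => (hρ n).2
  set S : Set C := {c | ∃ᶠ n in atTop, c ∈ s n}
  have hplay : G.toArena.IsPlay (fun n => (ρ n).1) := fun n => (hρ n).1
  have hobj : (fun n => (ρ n).1) ∈ G.objective ↔ G.φ.SatSet S :=
    (and_iff_right hplay).trans (G.φ.sat_iff_satSet s)
  rw [hobj]
  have hΩ (n : ℕ) := G.parityGame_Ω (ρ n) (ρ (n + 1))
  -- Whenever the maximal position is hit late enough, the formula is evaluated at `S` itself.
  have hmax : ∀ᶠ n in atTop, (ρ n).2.lastPos (s n) = m →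
      G.φ.SatSet ((ρ n).2.firstColors ((ρ n).2.lastPos (s n))) = G.φ.SatSet S := by
    filter_upwards [hev] with n hn hnm
    rw [hnm, hn.2]
  constructor
  · intro hS
    refine ⟨hρ, 2 * m, even_two_mul m, ?_, fun j hj => ?_⟩
    · rw [← Nat.frequently_atTop_iff_infinite]
      refine (hfreq.and_eventually hmax).mono fun n ⟨h₁, h₂⟩ => ?_
      rw [hΩ, if_pos ((h₂ h₁).mpr hS)]
      exact congrArg (2 * ·) h₁
    · rw [← Set.not_infinite, ← Nat.frequently_atTop_iff_infinite, not_frequently]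
      filter_upwards [hev, hmax] with n hn hn'
      rw [hΩ]
      have hle := hn.1
      change ¬ (if G.φ.SatSet ((ρ n).2.firstColors ((ρ n).2.lastPos (s n)))
        then 2 * (ρ n).2.lastPos (s n) else 2 * (ρ n).2.lastPos (s n) + 1) = j
      rcases hle.lt_or_eq with h | h
      · split_ifs <;> omega
      · rw [if_pos ((hn' h).mpr hS)]
        omega
  · rintro ⟨-, i, hi, hinf, hfin⟩
    by_contra hS
    have hodd : {n | G.parityGame.Ω (ρ n) (ρ (n + 1)) = 2 * m + 1}.Infinite := by
      rw [← Nat.frequently_atTop_iff_infinite]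
      refine (hfreq.and_eventually hmax).mono fun n ⟨h₁, h₂⟩ => ?_
      rw [hΩ, if_neg fun h => hS ((h₂ h₁).mp h)]
      exact congrArg (2 * · + 1) h₁
    -- Eventually no priority exceeds `2 * m + 1`, so `i` would equal this odd number.
    have hge : 2 * m + 1 ≤ i := by
      by_contra h
      exact hodd (hfin _ (not_le.mp h))
    rw [← Nat.frequently_atTop_iff_infinite] at hinf
    obtain ⟨n, hn, hle, -⟩ := (hinf.and_eventually hev).exists
    rw [hΩ] at hn
    change (if G.φ.SatSet ((ρ n).2.firstColors ((ρ n).2.lastPos (s n)))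
        then 2 * (ρ n).2.lastPos (s n) else 2 * (ρ n).2.lastPos (s n) + 1) = i at hn
    change (ρ n).2.lastPos (s n) ≤ m at hle
    rw [Nat.even_iff] at hi
    split_ifs at hn <;> omega

/-! ## Transfer of strategies -/

/-- The permutations along the sequence `ρ` of nodes, starting with `π`. -/
def perms (π : ColorPerm C) (ρ : ℕ → V) : ℕ → ColorPerm C
  | 0 => π
  | n + 1 => (perms π ρ n).moveToFront (G.γ (ρ n) (ρ (n + 1)))

/-- The sequence of nodes of the parity game, starting with the permutation `π`, over a sequence of
nodes. -/
def annotate (π : ColorPerm C) (ρ : ℕ → V) (n : ℕ) : V × ColorPerm C := (ρ n, G.perms π ρ n)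

/-- The finite play of the parity game, starting with the permutation `π`, over a finite play;
`d` is a default node. -/
def annotateList (π : ColorPerm C) (d : V) (l : List V) : List (V × ColorPerm C) :=
  (List.range l.length).map (G.annotate π (fun i => l.getD i d))

theorem perms_congr (π : ColorPerm C) {ρ ρ' : ℕ → V} {n : ℕ} (h : ∀ i ≤ n, ρ i = ρ' i) :
    G.perms π ρ n = G.perms π ρ' n := by
  induction n with
  | zero => rfl
  | succ n ih =>
    rw [perms, perms, ih fun i hi => h i (hi.trans n.le_succ), h n n.le_succ, h (n + 1) le_rfl]

theorem annotateList_map_range (π : ColorPerm C) (d : V) (ρ : ℕ → V) (k : ℕ) :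
    G.annotateList π d ((List.range k).map ρ) = (List.range k).map (G.annotate π ρ) := by
  have h : ∀ i < k, ((List.range k).map ρ).getD i d = ρ i := fun i hi => by
    simp [hi]
  simp only [annotateList, List.length_map, List.length_range]
  refine List.map_congr_left fun n hn => ?_
  have hn : n < k := List.mem_range.mp hn
  exact Prod.ext (h n hn) (G.perms_congr π fun i hi => h i (hi.trans_lt hn))

theorem isChain_annotate_range {π : ColorPerm C} {ρ : ℕ → V} {k : ℕ}
    (h : ((List.range (k + 1)).map ρ).IsChain G.E) :
    ((List.range (k + 1)).map (G.annotate π ρ)).IsChain G.parityGame.E := by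
  rw [List.isChain_map, List.isChain_range_succ] at h ⊢
  exact fun m hm => ⟨h m hm, rfl⟩

theorem isPlay_annotate {π : ColorPerm C} {ρ : ℕ → V} (h : G.toArena.IsPlay ρ) :
    G.parityGame.IsPlay (G.annotate π ρ) :=
  fun n => ⟨h n, rfl⟩

/-- The strategy forgets the permutations of the history, and the next permutation is forced; the
default of `getLastD` is never used on the nonempty histories. -/
theorem parityGame_wins_of_wins {v : V} (π : ColorPerm C) (h : G.Wins v) :
    G.parityGame.Wins (v, π) := by
  obtain ⟨σ, hσ, hwin⟩ := h
  let τ : List (V × ColorPerm C) → V × ColorPerm C := fun l =>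
    (σ (l.map Prod.fst), (l.getLastD (v, π)).2.moveToFront
      (G.γ (l.getLastD (v, π)).1 (σ (l.map Prod.fst))))
  refine ⟨τ, ?_, ?_⟩
  · intro h x hchain hx
    have hchain' : (h.map Prod.fst ++ [x.1]).IsChain G.E := by
      have := (List.isChain_map (R := G.E) Prod.fst).mpr (hchain.imp fun _ _ hab => hab.1)
      simpa using this
    have hmove := hσ (h.map Prod.fst) x.1 hchain' hx
    refine ⟨?_, ?_⟩
    · simpa [τ] using hmove
    · simp [τ]
  · intro ρ hρ hρ0 hcomp
    rw [← mem_objective_iff_mem_parityGame_objective G hρ]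
    refine hwin _ (fun n => (hρ n).1) (by simp [hρ0]) fun j hj => ?_
    have := congrArg Prod.fst (hcomp j hj)
    simpa [τ, Function.comp_def] using this

/-- The strategy recomputes the permutations from the history, so compatible plays lift to
compatible annotated plays. -/
theorem wins_of_parityGame_wins {v : V} {π : ColorPerm C} (h : G.parityGame.Wins (v, π)) :
    G.Wins v := by
  obtain ⟨τ, hτ, hwin⟩ := h
  have hmove (ρ : ℕ → V) (k : ℕ) (hchain : ((List.range (k + 1)).map ρ).IsChain G.E)
      (hk : ρ k ∈ G.VE) :
      G.parityGame.E (G.annotate π ρ k) (τ ((List.range (k + 1)).map (G.annotate π ρ))) := by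
    have hchain' := G.isChain_annotate_range (π := π) hchain
    simp only [List.range_succ, List.map_append, List.map_cons, List.map_nil] at hchain' ⊢
    exact hτ _ _ hchain' hk
  refine ⟨fun l => (τ (G.annotateList π v l)).1, ?_, ?_⟩
  · intro h x hchain hx
    -- Padding the finite play to an infinite sequence lets `hmove` apply; the padding lies beyond
    -- the prefix used.
    let ρ : ℕ → V := fun i => (h ++ [x]).getD i v
    have hρ : h ++ [x] = (List.range (h.length + 1)).map ρ := by
      refine List.ext_getElem (by simp) fun i h₁ h₂ => ?_
      rw [List.getElem_map, List.getElem_range]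
      exact (List.getD_eq_getElem _ _ h₁).symm
    have hx' : ρ h.length = x := by simp [ρ]
    rw [hρ] at hchain
    have := (hmove ρ h.length hchain (by rwa [hx'])).1
    simp only
    rw [hρ, annotateList_map_range]
    simpa [annotate, hx'] using this
  · intro ρ hρ hρ0 hcomp
    have hplay := G.isPlay_annotate (π := π) hρ
    refine (G.mem_objective_iff_mem_parityGame_objective hplay).mpr
      (hwin _ hplay (Prod.ext hρ0 rfl) fun j hj => ?_)
    have hchain : ((List.range (j + 1)).map ρ).IsChain G.E := by
      rw [List.isChain_map, List.isChain_range_succ]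
      exact fun m _ => hρ m
    have hfst := hcomp j hj
    simp only [annotateList_map_range] at hfst
    refine Prod.ext hfst ?_
    rw [(hmove ρ j hchain hj).2, ← hfst]
    rfl

end ELGame

theorem mainTheorem7 {V : Type u} {C : Type w} [Fintype C] (G : ELGame V C) :
    Cardinal.mk (V × ColorPerm C)
        = Cardinal.lift.{w} (Cardinal.mk V) * ((Nat.factorial (Fintype.card C) : ℕ) : Cardinal) ∧
    G.parityGame.priorities ⊆ Set.Icc 0 (2 * Fintype.card C + 1) ∧
    (∀ x y : V × ColorPerm C, G.parityGame.E x y →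
      ((G.γ x.1 y.1).Nonempty ∨ ¬ G.φ.SatSet ∅) →
        G.parityGame.Ω x y ∈ Set.Icc 1 (2 * Fintype.card C + 1)) ∧
    G.parityGame.priorities.encard ≤ ((2 * Fintype.card C + 1 : ℕ) : ℕ∞) ∧
    ∀ (v : V) (π : ColorPerm C), G.Wins v ↔ G.parityGame.Wins (v, π) := by
  refine ⟨?_, ?_, fun x y _ h => ⟨G.one_le_parityGame_Ω x y h, G.parityGame_Ω_le x y⟩,
    G.encard_priorities_parityGame_le,
    fun v π => ⟨G.parityGame_wins_of_wins π, G.wins_of_parityGame_wins⟩⟩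
  · classical
    rw [Cardinal.mk_prod, Cardinal.mk_fintype (ColorPerm C),
      Fintype.card_equiv (Fintype.equivFin C).symm, Fintype.card_fin, Cardinal.lift_natCast]
  · rintro _ ⟨x, y, -, rfl⟩
    exact ⟨Nat.zero_le _, G.parityGame_Ω_le x y⟩
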